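/- **Conventions.** An $\infty$-graph (globular set) $X$ consists of sets $X_m$ of $m$-cells ($m\ge 0$) with maps $s,t:X_{m+1}\to X_m$ such that $ss=st$ and $tt=ts$; write $s^m_p,t^m_p:X_m\to X_p$ for the iterated sources and targets. It is reflexive if it has maps $1^m_{m+1}:X_m\to X_{m+1}$ with $s1^m_{m+1}=t1^m_{m+1}=\mathrm{id}$; then $1^p_m$ is the composite $1^{m-1}_m\cdots 1^p_{p+1}$, and the cells $1^p_m(x)$ with $p<m$ are the identity cells. An $\infty$-magma is a reflexive $\infty$-graph with, for all $0\le p<m$, an operation $(y,x)\mapsto y\circ^m_p x\in X_m$ defined for $x,y\in X_m$ with $s^m_p(y)=t^m_p(x)$, subject only to the positional axioms: for $m>p+1$, $s(y\circ^m_p x)=s(y)\circ^{m-1}_p s(x)$ and $t(y\circ^m_p x)=t(y)\circ^{m-1}_p t(x)$; for $m=p+1$, $s(y\circ^m_p x)=s(x)$ and $t(y\circ^m_p x)=t(y)$. An $(\infty,n)$-magma has moreover reversors $j^m_p:X_m\to X_m$ ($n\le p<m$) with $s j^{m}_p=j^{m-1}_p s$, $t j^{m}_p=j^{m-1}_p t$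 for $m>p+1$, and $s j^{p+1}_p=t$, $t j^{p+1}_p=s$. A cell $\beta\in X_m$ is a $\circ^m_p$-inverse of $\alpha\in X_m$ if $\alpha\circ^m_p\beta$ and $\beta\circ^m_p\alpha$ are defined and equal to $1^p_m(t^m_p\alpha)$ and $1^p_m(s^m_p\alpha)$ respectively. A strict $(\infty,n)$-category is a strict $\infty$-category (an $\infty$-magma satisfying associativity, the unit laws, the interchange laws and $1^m_{m+1}(y\circ^m_p x)=1^m_{m+1}(y)\circ^{m+1}_p1^m_{m+1}(x)$) in which every $m$-cell $\alpha$ has a (necessarily unique) $\circ^m_p$-inverse for $n\le p<m$; it is regarded as an $(\infty,n)$-magma with $j^m_p(\alpha)$ this inverse. An $(\infty,n)$-categorical stretching $(M,C,\pi,[-,-])$ consists of an $(\infty,n)$-magma $M$, a strict $(\infty,n)$-category $C$, a morphism of $(\infty,n)$-magmas $\pi:M\to C$ and, for all $m\ge 0$ and all parallel $c_1,c_0\in M_m$ with $\pi(c_1)=\pi(c_0)$ (parallel means same source and same target; any two $0$-cells are parallel), a cell $[c_1,c_0]\in M_{m+1}$ with target $c_1$ and source $c_0$, such that $\pi[c_1,c_0]=1^m_{m+1}(\pi(c_1))$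 and $[c,c]=1^m_{m+1}(c)$. Morphisms are commutative squares of morphisms of $(\infty,n)$-magmas preserving the brackets. The forgetful functor $(M,C,\pi,[-,-])\mapsto M$ to $\infty$-graphs has a left adjoint, and $\mathbb T^{(\infty,n)}$ denotes the induced monad on $\infty$-graphs, with unit $\lambda$. If $(G,v)$ is a $\mathbb T^{(\infty,n)}$-algebra, $G$ is an $(\infty,n)$-magma with $$a\circ^m_p b=v(\lambda_G(a)\circ^m_p\lambda_G(b)),\qquad \iota^p_m(a)=v(1^p_m(\lambda_G(a))),\qquad i^m_p(a)=v(j^m_p(\lambda_G(a))),$$ where the operations inside $v$ are those of the magma $M$ of the free stretching on $G$. The algebra $(G,v)$ has dimension $1$ if, for these reflexors $\iota$, every $q$-cell of $G$ with $q>1$ is an identity cell and at least one $1$-cell is not an identity cell. **Proposition.** Let $(G,v)$ be a $\mathbb T^{(\infty,0)}$-algebra (a weak $\infty$-groupoid) of dimension $1$. Then for every $1$-cell $f:a\to b$ of $G$, the $1$-cell $i^1_0(f):b\to a$ is a $\circ^1_0$-inverse of $f$: $$f\circ^1_0 i^1_0(f)=\iota^0_1(b),\qquad i^1_0(f)\circ^1_0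 f=\iota^0_1(a).$$ Moreover the $0$-cells of $G$ as objects and the $1$-cells of $G$ as arrows, with composition $\circ^1_0$, identities $\iota^0_1$ and inverses $i^1_0$, form a groupoid in the ordinary sense. -/

import Mathlib

open CategoryTheory

universe u

namespace Glob

/-! ## Globular sets -/

/-- An `∞`-graph (globular set). -/
structure InfGraph where
  cell : ℕ → Type u
  src : ∀ m, cell (m + 1) → cell m
  tgt : ∀ m, cell (m + 1) → cell m
  src_src : ∀ m (x : cell (m + 2)), src m (src (m + 1) x) = src m (tgt (m + 1) x)
  tgt_tgt : ∀ m (x : cell (m + 2)), tgt m (tgt (m + 1) x) = tgt m (src (m + 1) x)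

namespace InfGraph

/-- The iterated source `s^m_p`, for `p ≤ m` (it is the identity for `p = m`). -/
def srcTo (X : InfGraph.{u}) {p m : ℕ} (h : p ≤ m) : X.cell m → X.cell p :=
  Nat.leRec (motive := fun m _ => X.cell m → X.cell p) id (fun k _ f x => f (X.src k x)) h

/-- The iterated target `t^m_p`, for `p ≤ m`. -/
def tgtTo (X : InfGraph.{u}) {p m : ℕ} (h : p ≤ m) : X.cell m → X.cell p :=
  Nat.leRec (motive := fun m _ => X.cell m → X.cell p) id (fun k _ f x => f (X.tgt k x)) h

theorem srcTo_self (X : InfGraph.{u}) {p : ℕ} (h : p ≤ p) (x : X.cell p) :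
    X.srcTo h x = x := by
  unfold srcTo; rw [Nat.leRec_self]; rfl

theorem tgtTo_self (X : InfGraph.{u}) {p : ℕ} (h : p ≤ p) (x : X.cell p) :
    X.tgtTo h x = x := by
  unfold tgtTo; rw [Nat.leRec_self]; rfl

theorem srcTo_succ (X : InfGraph.{u}) {p m : ℕ} (h : p ≤ m) (h' : p ≤ m + 1)
    (x : X.cell (m + 1)) : X.srcTo h' x = X.srcTo h (X.src m x) := by
  unfold srcTo; rw [Nat.leRec_succ (h1 := h)]

theorem tgtTo_succ (X : InfGraph.{u}) {p m : ℕ} (h : p ≤ m) (h' : p ≤ m + 1)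
    (x : X.cell (m + 1)) : X.tgtTo h' x = X.tgtTo h (X.tgt m x) := by
  unfold tgtTo; rw [Nat.leRec_succ (h1 := h)]

/-- Morphisms of `∞`-graphs. -/
@[ext] structure Hom (X Y : InfGraph.{u}) where
  map : ∀ m, X.cell m → Y.cell m
  map_src : ∀ m x, map m (X.src m x) = Y.src m (map (m + 1) x)
  map_tgt : ∀ m x, map m (X.tgt m x) = Y.tgt m (map (m + 1) x)

theorem Hom.map_srcTo {X Y : InfGraph.{u}} (f : Hom X Y) {p m : ℕ} (h : p ≤ m) :
    ∀ x : X.cell m, f.map p (X.srcTo h x) = Y.srcTo h (f.map m x) := by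
  induction h using Nat.leRec with
  | refl => intro x; rw [srcTo_self, srcTo_self]
  | le_succ_of_le h ih => intro x; rw [srcTo_succ _ h, srcTo_succ _ h, ih, f.map_src]

theorem Hom.map_tgtTo {X Y : InfGraph.{u}} (f : Hom X Y) {p m : ℕ} (h : p ≤ m) :
    ∀ x : X.cell m, f.map p (X.tgtTo h x) = Y.tgtTo h (f.map m x) := by
  induction h using Nat.leRec with
  | refl => intro x; rw [tgtTo_self, tgtTo_self]
  | le_succ_of_le h ih => intro x; rw [tgtTo_succ _ h, tgtTo_succ _ h, ih, f.map_tgt]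

theorem Hom.composable {X Y : InfGraph.{u}} (f : Hom X Y) {p m : ℕ} (h : p ≤ m) {y x : X.cell m}
    (c : X.srcTo h y = X.tgtTo h x) : Y.srcTo h (f.map m y) = Y.tgtTo h (f.map m x) := by
  rw [← f.map_srcTo, ← f.map_tgtTo, c]

instance : Category InfGraph.{u} where
  Hom := Hom
  id X := ⟨fun _ x => x, fun _ _ => rfl, fun _ _ => rfl⟩
  comp f g := ⟨fun m x => g.map m (f.map m x),
    fun m x => by rw [f.map_src, g.map_src], fun m x => by rw [f.map_tgt, g.map_tgt]⟩

end InfGraph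

/-! ## Reflexive graphs and dimension -/

/-- A reflexive `∞`-graph, with `refl m` the reflexor `1^m_{m+1}`. -/
structure ReflGraph extends InfGraph.{u} where
  refl : ∀ m, cell m → cell (m + 1)
  src_refl : ∀ m x, src m (refl m x) = x
  tgt_refl : ∀ m x, tgt m (refl m x) = x

namespace ReflGraph

/-- The reflexor `1^p_m`, for `p ≤ m`: the composite `1^{m-1}_m ∘ ⋯ ∘ 1^p_{p+1}`. -/
def one (X : ReflGraph.{u}) {p m : ℕ} (h : p ≤ m) : X.cell p → X.cell m :=
  Nat.leRec (motive := fun m _ => X.cell p → X.cell m) id (fun k _ f x => X.refl k (f x)) h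

/-- An `m`-cell is an identity cell when it is `1^p_m(x)` for some `p < m` and some `p`-cell `x`. -/
def IsIdentity (X : ReflGraph.{u}) {m : ℕ} (c : X.cell m) : Prop :=
  ∃ (p : ℕ) (h : p < m) (x : X.cell p), c = X.one h.le x

/-- A reflexive `∞`-graph has dimension `d` if all its `q`-cells with `q > d` are identity cells
and at least one `d`-cell is not an identity cell. -/
def HasDimension (X : ReflGraph.{u}) (d : ℕ) : Prop :=
  (∀ q, d < q → ∀ c : X.cell q, X.IsIdentity c) ∧ ∃ c : X.cell d, ¬ X.IsIdentity c

end ReflGraph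

/-! ## Magmas

In the axioms below the hypotheses stating that two cells are composable are universally
quantified; those about composites and faces follow from the others by the positional axioms. -/

/-- An `∞`-magma: a reflexive `∞`-graph with operations `comp h y x = y ∘^m_p x`, defined when
`s^m_p(y) = t^m_p(x)`, subject to the positional axioms only. -/
structure InfMagma extends ReflGraph.{u} where
  comp : ∀ {p m : ℕ} (h : p < m) (y x : cell m),
    toInfGraph.srcTo h.le y = toInfGraph.tgtTo h.le x → cell m
  src_comp_lt : ∀ {p m : ℕ} (h : p < m) (h' : p < m + 1) (y x : cell (m + 1)) (c c'),
    src m (comp h' y x c) = comp h (src m y) (src m x) c'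
  tgt_comp_lt : ∀ {p m : ℕ} (h : p < m) (h' : p < m + 1) (y x : cell (m + 1)) (c c'),
    tgt m (comp h' y x c) = comp h (tgt m y) (tgt m x) c'
  src_comp : ∀ {p : ℕ} (h : p < p + 1) (y x : cell (p + 1)) (c), src p (comp h y x c) = src p x
  tgt_comp : ∀ {p : ℕ} (h : p < p + 1) (y x : cell (p + 1)) (c), tgt p (comp h y x c) = tgt p y

theorem InfMagma.comp_congr (X : InfMagma.{u}) {p m : ℕ} (h : p < m)
    {y y' x x' : X.cell m} (hy : y = y') (hx : x = x') (c) :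
    X.comp h y x c = X.comp h y' x' (by rw [← hy, ← hx]; exact c) := by
  subst hy hx; rfl

/-- `β` is a `∘^m_p`-inverse of `α`: one has `α ∘^m_p β = 1^p_m(t^m_p(α))` and
`β ∘^m_p α = 1^p_m(s^m_p(α))`. -/
def InfMagma.IsInverse (X : InfMagma.{u}) {p m : ℕ} (h : p < m) (α β : X.cell m) : Prop :=
  (∃ c, X.comp h α β c = X.one h.le (X.tgtTo h.le α)) ∧
  (∃ c, X.comp h β α c = X.one h.le (X.srcTo h.le α))

/-- The axioms of strict `∞`-categories, for an `∞`-magma. -/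
structure InfMagma.IsStrictCat (X : InfMagma.{u}) : Prop where
  assoc : ∀ {p m : ℕ} (h : p < m) (z y x : X.cell m) (c₁ c₂ c₃ c₄),
    X.comp h (X.comp h z y c₁) x c₂ = X.comp h z (X.comp h y x c₃) c₄
  comp_one : ∀ {p m : ℕ} (h : p < m) (x : X.cell m) (c),
    X.comp h x (X.one h.le (X.srcTo h.le x)) c = x
  one_comp : ∀ {p m : ℕ} (h : p < m) (x : X.cell m) (c),
    X.comp h (X.one h.le (X.tgtTo h.le x)) x c = x
  interchange : ∀ {q p m : ℕ}, q < p → ∀ (hpm : p < m) (hqm : q < m) (w z y x : X.cell m)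
    (c₁ c₂ c₃ c₄ c₅ c₆),
    X.comp hqm (X.comp hpm w z c₁) (X.comp hpm y x c₂) c₃ =
      X.comp hpm (X.comp hqm w y c₄) (X.comp hqm z x c₅) c₆
  refl_comp : ∀ {p m : ℕ} (h : p < m) (h' : p < m + 1) (y x : X.cell m) (c c'),
    X.refl m (X.comp h y x c) = X.comp h' (X.refl m y) (X.refl m x) c'

/-- An `(∞,n)`-magma: an `∞`-magma with reversors `rev _ _ = j^m_p` for `n ≤ p < m`, the
reversor `j^m_p` commuting with sources and targets above dimension `p + 1` and exchanging the
source and the target of `(p + 1)`-cells. -/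
structure NMagma (n : ℕ) extends InfMagma.{u} where
  rev : ∀ {p m : ℕ}, n ≤ p → p < m → cell m → cell m
  src_rev_lt : ∀ {p m : ℕ} (hn : n ≤ p) (h : p < m) (h' : p < m + 1) (x : cell (m + 1)),
    src m (rev hn h' x) = rev hn h (src m x)
  tgt_rev_lt : ∀ {p m : ℕ} (hn : n ≤ p) (h : p < m) (h' : p < m + 1) (x : cell (m + 1)),
    tgt m (rev hn h' x) = rev hn h (tgt m x)
  src_rev : ∀ {p : ℕ} (hn : n ≤ p) (h : p < p + 1) (x : cell (p + 1)),
    src p (rev hn h x) = tgt p x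
  tgt_rev : ∀ {p : ℕ} (hn : n ≤ p) (h : p < p + 1) (x : cell (p + 1)),
    tgt p (rev hn h x) = src p x

/-- Morphisms of `(∞,n)`-magmas. -/
@[ext] structure NMagma.Hom {n : ℕ} (X Y : NMagma.{u} n)
    extends InfGraph.Hom X.toInfGraph Y.toInfGraph where
  map_refl : ∀ m x, map (m + 1) (X.refl m x) = Y.refl m (map m x)
  map_comp : ∀ {p m : ℕ} (h : p < m) (y x : X.cell m) (c c'),
    map m (X.comp h y x c) = Y.comp h (map m y) (map m x) c'
  map_rev : ∀ {p m : ℕ} (hn : n ≤ p) (h : p < m) (x : X.cell m),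
    map m (X.rev hn h x) = Y.rev hn h (map m x)

/-- A strict `(∞,n)`-category, seen as an `(∞,n)`-magma: the underlying `∞`-magma is a strict
`∞`-category in which every `m`-cell has a `∘^m_p`-inverse for `n ≤ p < m`, and the reversor
`j^m_p` is the (unique) operation giving this inverse. -/
structure NMagma.IsStrict {n : ℕ} (X : NMagma.{u} n) : Prop where
  isStrictCat : X.IsStrictCat
  isInverse_rev : ∀ {p m : ℕ} (hn : n ≤ p) (h : p < m) (α : X.cell m),
    X.IsInverse h α (X.rev hn h α)

/-! ## Categorical stretchings -/

/-- Two `m`-cells are parallel when they have the same source and the same target; any two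
`0`-cells are parallel. -/
def InfGraph.Parallel (X : InfGraph.{u}) : ∀ {m : ℕ}, X.cell m → X.cell m → Prop
  | 0, _, _ => True
  | m + 1, c₁, c₀ => X.src m c₁ = X.src m c₀ ∧ X.tgt m c₁ = X.tgt m c₀

/-- An `(∞,n)`-categorical stretching: a morphism `proj` from an `(∞,n)`-magma `M` to a strict
`(∞,n)`-category `C`, with a bracketing structure `[c₁, c₀]`. -/
structure Stretching (n : ℕ) where
  M : NMagma.{u} n
  C : NMagma.{u} n
  isStrict : C.IsStrict
  proj : NMagma.Hom M C
  bracket : ∀ {m : ℕ} (c₁ c₀ : M.cell m), M.Parallel c₁ c₀ →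
    proj.map m c₁ = proj.map m c₀ → M.cell (m + 1)
  tgt_bracket : ∀ {m : ℕ} (c₁ c₀ : M.cell m) (h h'), M.tgt m (bracket c₁ c₀ h h') = c₁
  src_bracket : ∀ {m : ℕ} (c₁ c₀ : M.cell m) (h h'), M.src m (bracket c₁ c₀ h h') = c₀
  proj_bracket : ∀ {m : ℕ} (c₁ c₀ : M.cell m) (h h'),
    proj.map (m + 1) (bracket c₁ c₀ h h') = C.refl m (proj.map m c₁)
  bracket_self : ∀ {m : ℕ} (c : M.cell m) (h h'), bracket c c h h' = M.refl m c

namespace Stretching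

/-- Morphisms of `(∞,n)`-categorical stretchings. -/
@[ext] structure Hom {n : ℕ} (E E' : Stretching.{u} n) where
  mapM : NMagma.Hom E.M E'.M
  mapC : NMagma.Hom E.C E'.C
  comm : ∀ m x, E'.proj.map m (mapM.map m x) = mapC.map m (E.proj.map m x)
  map_bracket : ∀ {m : ℕ} (c₁ c₀ : E.M.cell m) (h h' k k'),
    mapM.map (m + 1) (E.bracket c₁ c₀ h h') =
      E'.bracket (mapM.map m c₁) (mapM.map m c₀) k k'

end Stretching

theorem InfGraph.Hom.map_parallel {X Y : InfGraph.{u}} (f : InfGraph.Hom X Y) :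
    ∀ {m : ℕ} {c₁ c₀ : X.cell m}, X.Parallel c₁ c₀ → Y.Parallel (f.map m c₁) (f.map m c₀)
  | 0, _, _, _ => trivial
  | m + 1, _, _, h => ⟨by rw [← f.map_src, ← f.map_src, h.1], by rw [← f.map_tgt, ← f.map_tgt, h.2]⟩

namespace NMagma.Hom

theorem map_comp_eq {n : ℕ} {X Y : NMagma.{u} n} (f : Hom X Y) {p m : ℕ} (h : p < m)
    (y x : X.cell m) (c) : f.map m (X.comp h y x c) =
      Y.comp h (f.map m y) (f.map m x) (f.composable h.le c) :=
  f.map_comp h y x c _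

theorem map_one {n : ℕ} {X Y : NMagma.{u} n} (f : Hom X Y)
    {p m : ℕ} (h : p ≤ m) (x : X.cell p) : f.map m (X.one h x) = Y.one h (f.map p x) := by
  unfold ReflGraph.one
  induction h using Nat.leRec with
  | refl => rw [Nat.leRec_self, Nat.leRec_self]; rfl
  | le_succ_of_le h ih => rw [Nat.leRec_succ (h1 := h), Nat.leRec_succ (h1 := h), f.map_refl, ih]

def idHom {n : ℕ} (X : NMagma.{u} n) : Hom X X where
  map _ x := x
  map_src _ _ := rfl
  map_tgt _ _ := rfl
  map_refl _ _ := rfl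
  map_comp _ _ _ _ _ := rfl
  map_rev _ _ _ := rfl

def compHom {n : ℕ} {X Y Z : NMagma.{u} n} (f : Hom X Y) (g : Hom Y Z) : Hom X Z where
  map m x := g.map m (f.map m x)
  map_src m x := by rw [f.map_src, g.map_src]
  map_tgt m x := by rw [f.map_tgt, g.map_tgt]
  map_refl m x := by rw [f.map_refl, g.map_refl]
  map_comp h y x c c' := by
    rw [f.map_comp h y x c (by rw [← f.map_srcTo, ← f.map_tgtTo, c]), g.map_comp h]
  map_rev hn h x := by rw [f.map_rev, g.map_rev]

end NMagma.Hom

namespace Stretching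

instance (n : ℕ) : Category (Stretching.{u} n) where
  Hom := Hom
  id E := ⟨.idHom _, .idHom _, fun _ _ => rfl, fun _ _ _ _ _ _ => rfl⟩
  comp {E E' E''} f g := ⟨f.mapM.compHom g.mapM, f.mapC.compHom g.mapC,
    fun m x => by
      change E''.proj.map m (g.mapM.map m (f.mapM.map m x)) = g.mapC.map m (f.mapC.map m _)
      rw [g.comm, f.comm],
    fun c₁ c₀ h h' k k' => by
      change g.mapM.map _ (f.mapM.map _ _) = E''.bracket (g.mapM.map _ (f.mapM.map _ _)) _ k k'
      rw [f.map_bracket c₁ c₀ h h' (f.mapM.map_parallel h) (by rw [f.comm, f.comm, h'])]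
      exact g.map_bracket _ _ _ _ k k'⟩

/-- The forgetful functor sending `(M, C, π, [-,-])` to the `∞`-graph underlying `M`. -/
def forget (n : ℕ) : Stretching.{u} n ⥤ InfGraph.{u} where
  obj E := E.M.toInfGraph
  map f := f.mapM.toHom

/-! ## The free stretching on an `∞`-graph

It is built from formal terms. A term is interpreted, when possible, in all stretchings under the
given graph; two interpretable terms are identified when they have the same interpretations. -/

/-- A stretching under the graph `G`. -/
structure Under (n : ℕ) (G : InfGraph.{u}) where
  E : Stretching.{u} n
  g : InfGraph.Hom G E.M.toInfGraph

/-- The two magmas of a stretching: `M` for `true` and `C` for `false`. -/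
abbrev mag {n : ℕ} (E : Stretching.{u} n) : Bool → NMagma.{u} n
  | true => E.M
  | false => E.C

/-- Formal terms. -/
inductive Tm (n : ℕ) (G : InfGraph.{u}) : Bool → ℕ → Type u
  | gen {m : ℕ} (g : G.cell m) : Tm n G true m
  | proj {m : ℕ} (t : Tm n G true m) : Tm n G false m
  | src {s : Bool} {m : ℕ} (t : Tm n G s (m + 1)) : Tm n G s m
  | tgt {s : Bool} {m : ℕ} (t : Tm n G s (m + 1)) : Tm n G s m
  | refl {s : Bool} {m : ℕ} (t : Tm n G s m) : Tm n G s (m + 1)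
  | comp {s : Bool} {p m : ℕ} (h : p < m) (t t' : Tm n G s m) : Tm n G s m
  | rev {s : Bool} {p m : ℕ} (hn : n ≤ p) (h : p < m) (t : Tm n G s m) : Tm n G s m
  | bracket {m : ℕ} (t t' : Tm n G true m) : Tm n G true (m + 1)

/-- Families of cells, one in each stretching under `G`. -/
abbrev Val (n : ℕ) (G : InfGraph.{u}) (s : Bool) (m : ℕ) : Type (u + 1) :=
  ∀ X : Under.{u} n G, (X.E.mag s).cell m

/-- `Den t v`: the term `t` is interpretable, with interpretations `v`. -/
def Den {n : ℕ} {G : InfGraph.{u}} : ∀ {s : Bool} {m : ℕ}, Tm n G s m → Val n G s m → Prop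
  | _, _, .gen g, v => v = fun X => X.g.map _ g
  | _, _, .proj t, v => ∃ w : Val n G true _, Den t w ∧ v = fun X => X.E.proj.map _ (w X)
  | _, _, .src t, v => ∃ w, Den t w ∧ v = fun X => (X.E.mag _).src _ (w X)
  | _, _, .tgt t, v => ∃ w, Den t w ∧ v = fun X => (X.E.mag _).tgt _ (w X)
  | _, _, .refl t, v => ∃ w, Den t w ∧ v = fun X => (X.E.mag _).refl _ (w X)
  | _, _, .comp h t t', v => ∃ w w', Den t w ∧ Den t' w' ∧
      ∃ c : ∀ X : Under.{u} n G, (X.E.mag _).srcTo h.le (w X) = (X.E.mag _).tgtTo h.le (w' X),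
        v = fun X => (X.E.mag _).comp h (w X) (w' X) (c X)
  | _, _, .rev hn h t, v => ∃ w, Den t w ∧ v = fun X => (X.E.mag _).rev hn h (w X)
  | _, _, .bracket t t', v => ∃ w w' : Val n G true _, Den t w ∧ Den t' w' ∧
      ∃ (k : ∀ X : Under.{u} n G, X.E.M.Parallel (w X) (w' X))
        (k' : ∀ X : Under.{u} n G, X.E.proj.map _ (w X) = X.E.proj.map _ (w' X)),
        v = fun X => X.E.bracket (w X) (w' X) (k X) (k' X)

theorem Den.unique {n : ℕ} {G : InfGraph.{u}} {s : Bool} {m : ℕ} (t : Tm n G s m) :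
    ∀ {v v' : Val n G s m}, Den t v → Den t v' → v = v' := by
  induction t with
  | gen g => rintro v v' rfl rfl; rfl
  | proj t ih | src t ih | tgt t ih | refl t ih | rev _ _ t ih =>
    rintro v v' ⟨w, hw, rfl⟩ ⟨w', hw', rfl⟩
    obtain rfl := ih hw hw'; rfl
  | comp h t t' ih ih' =>
    rintro v v' ⟨w, x, hw, hx, c, rfl⟩ ⟨w', x', hw', hx', c', rfl⟩
    obtain rfl := ih hw hw'
    obtain rfl := ih' hx hx'; rfl
  | bracket t t' ih ih' =>
    rintro v v' ⟨w, x, hw, hx, k, c, rfl⟩ ⟨w', x', hw', hx', k', c', rfl⟩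
    obtain rfl := ih hw hw'
    obtain rfl := ih' hx hx'; rfl

instance {n : ℕ} {G : InfGraph.{u}} {s : Bool} {m : ℕ} :
    Small.{u} {v : Val n G s m // ∃ t, Den t v} := by
  refine small_of_injective (β := Tm n G s m) (f := fun v => v.2.choose) ?_
  intro v v' h
  have h₁ := v.2.choose_spec
  have h₂ := v'.2.choose_spec
  simp only at h
  rw [← h] at h₂
  exact Subtype.ext (Den.unique _ h₁ h₂)

/-- Cells of the free stretching: interpretable terms up to equality of interpretations. -/
def FreeCell (n : ℕ) (G : InfGraph.{u}) (s : Bool) (m : ℕ) : Type u :=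
  Shrink.{u} {v : Val n G s m // ∃ t, Den t v}

namespace FreeCell

variable {n : ℕ} {G : InfGraph.{u}} {s : Bool} {m : ℕ}

noncomputable def val (q : FreeCell n G s m) : Val n G s m := ((equivShrink _).symm q).1

theorem den (q : FreeCell n G s m) : ∃ t, Den t q.val := ((equivShrink _).symm q).2

noncomputable def ofVal (v : Val n G s m) (h : ∃ t, Den t v) : FreeCell n G s m :=
  equivShrink _ ⟨v, h⟩

@[simp] theorem val_ofVal (v : Val n G s m) (h) : (ofVal v h).val = v := by
  simp [val, ofVal]

theorem ext_val {q q' : FreeCell n G s m} (h : ∀ X, q.val X = q'.val X) : q = q' :=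
  (equivShrink _).symm.injective (Subtype.ext (funext h))

end FreeCell

open FreeCell

noncomputable def freeGraph (n : ℕ) (G : InfGraph.{u}) (s : Bool) : InfGraph.{u} where
  cell := FreeCell n G s
  src m q := ofVal (fun X => (X.E.mag s).src m (q.val X))
    (q.den.elim fun t h => ⟨.src t, _, h, rfl⟩)
  tgt m q := ofVal (fun X => (X.E.mag s).tgt m (q.val X))
    (q.den.elim fun t h => ⟨.tgt t, _, h, rfl⟩)
  src_src m q := ext_val fun X => by simp [(X.E.mag s).src_src]
  tgt_tgt m q := ext_val fun X => by simp [(X.E.mag s).tgt_tgt]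

/-- Interpretation of the free cells in a stretching under `G`. -/
noncomputable def evalHom {n : ℕ} {G : InfGraph.{u}} (s : Bool) (X : Under.{u} n G) :
    InfGraph.Hom (freeGraph n G s) (X.E.mag s).toInfGraph where
  map m q := FreeCell.val q X
  map_src m q := by simp [freeGraph]
  map_tgt m q := by simp [freeGraph]

theorem freeGraph_composable {n : ℕ} {G : InfGraph.{u}} {s : Bool} {p m : ℕ} (h : p ≤ m)
    {y x : FreeCell n G s m} (c : (freeGraph n G s).srcTo h y = (freeGraph n G s).tgtTo h x)
    (X : Under.{u} n G) :
    (X.E.mag s).srcTo h (y.val X) = (X.E.mag s).tgtTo h (x.val X) := by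
  exact (evalHom s X).composable h c

noncomputable def freeMagma (n : ℕ) (G : InfGraph.{u}) (s : Bool) : NMagma.{u} n where
  toInfGraph := freeGraph n G s
  refl m q := ofVal (fun X => (X.E.mag s).refl m (FreeCell.val q X))
    ((FreeCell.den q).elim fun t h => ⟨.refl t, _, h, rfl⟩)
  src_refl m q := ext_val fun X => by simp [freeGraph, (X.E.mag s).src_refl]
  tgt_refl m q := ext_val fun X => by simp [freeGraph, (X.E.mag s).tgt_refl]
  comp h y x c := ofVal
    (fun X => (X.E.mag s).comp h (FreeCell.val y X) (FreeCell.val x X)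
      (freeGraph_composable h.le c X))
    ((FreeCell.den y).elim fun t ht => (FreeCell.den x).elim fun t' ht' =>
      ⟨.comp h t t', _, _, ht, ht', _, rfl⟩)
  src_comp_lt h h' y x c c' := ext_val fun X => by
    simp only [freeGraph, val_ofVal]; exact (X.E.mag s).src_comp_lt h h' _ _ _ _
  tgt_comp_lt h h' y x c c' := ext_val fun X => by
    simp only [freeGraph, val_ofVal]; exact (X.E.mag s).tgt_comp_lt h h' _ _ _ _
  src_comp h y x c := ext_val fun X => by
    simp only [freeGraph, val_ofVal]; exact (X.E.mag s).src_comp h _ _ _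
  tgt_comp h y x c := ext_val fun X => by
    simp only [freeGraph, val_ofVal]; exact (X.E.mag s).tgt_comp h _ _ _
  rev hn h q := ofVal (fun X => (X.E.mag s).rev hn h (FreeCell.val q X))
    ((FreeCell.den q).elim fun t ht => ⟨.rev hn h t, _, ht, rfl⟩)
  src_rev_lt hn h h' x := ext_val fun X => by
    simp only [freeGraph, val_ofVal]; exact (X.E.mag s).src_rev_lt hn h h' _
  tgt_rev_lt hn h h' x := ext_val fun X => by
    simp only [freeGraph, val_ofVal]; exact (X.E.mag s).tgt_rev_lt hn h h' _
  src_rev hn h x := ext_val fun X => by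
    simp only [freeGraph, val_ofVal]; exact (X.E.mag s).src_rev hn h _
  tgt_rev hn h x := ext_val fun X => by
    simp only [freeGraph, val_ofVal]; exact (X.E.mag s).tgt_rev hn h _

noncomputable def evalMagHom {n : ℕ} {G : InfGraph.{u}} (s : Bool) (X : Under.{u} n G) :
    NMagma.Hom (freeMagma n G s) (X.E.mag s) where
  toHom := evalHom s X
  map_refl m q := by simp [evalHom, freeMagma]
  map_comp h y x c c' := by simp [evalHom, freeMagma]
  map_rev hn h q := by simp [evalHom, freeMagma]

theorem freeMagma_ext {n : ℕ} {G : InfGraph.{u}} {s : Bool} {m : ℕ}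
    {q q' : (freeMagma n G s).cell m}
    (h : ∀ X, (evalMagHom s X).map m q = (evalMagHom s X).map m q') : q = q' :=
  ext_val h

theorem freeMagma_isStrictCat (n : ℕ) (G : InfGraph.{u}) :
    (freeMagma n G false).IsStrictCat where
  assoc h z y x c₁ c₂ c₃ c₄ := freeMagma_ext fun X => by
    simp only [NMagma.Hom.map_comp_eq]
    exact X.E.isStrict.isStrictCat.assoc h _ _ _ _ _ _ _
  comp_one h x c := freeMagma_ext fun X => by
    simp only [NMagma.Hom.map_comp_eq, NMagma.Hom.map_one, InfGraph.Hom.map_srcTo]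
    exact X.E.isStrict.isStrictCat.comp_one h _ _
  one_comp h x c := freeMagma_ext fun X => by
    simp only [NMagma.Hom.map_comp_eq, NMagma.Hom.map_one, InfGraph.Hom.map_tgtTo]
    exact X.E.isStrict.isStrictCat.one_comp h _ _
  interchange hqp hpm hqm w z y x c₁ c₂ c₃ c₄ c₅ c₆ := freeMagma_ext fun X => by
    simp only [NMagma.Hom.map_comp_eq]
    exact X.E.isStrict.isStrictCat.interchange hqp hpm hqm _ _ _ _ _ _ _ _ _ _
  refl_comp h h' y x c c' := freeMagma_ext fun X => by
    simp only [NMagma.Hom.map_comp_eq, NMagma.Hom.map_refl]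
    exact X.E.isStrict.isStrictCat.refl_comp h h' _ _ _ _

theorem freeMagma_isStrict (n : ℕ) (G : InfGraph.{u}) : (freeMagma n G false).IsStrict where
  isStrictCat := freeMagma_isStrictCat n G
  isInverse_rev {p m} hn h α := by
    have key : ∀ X : Under.{u} n G, (X.E.mag false).IsInverse h ((evalMagHom false X).map m α)
        ((evalMagHom false X).map m ((freeMagma n G false).rev hn h α)) := fun X => by
      rw [NMagma.Hom.map_rev]
      exact X.E.isStrict.isInverse_rev hn h _
    refine ⟨⟨freeMagma_ext fun X => ?_, freeMagma_ext fun X => ?_⟩,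
      ⟨freeMagma_ext fun X => ?_, freeMagma_ext fun X => ?_⟩⟩
    · rw [InfGraph.Hom.map_srcTo, InfGraph.Hom.map_tgtTo]
      exact (key X).1.1
    · rw [NMagma.Hom.map_comp_eq, NMagma.Hom.map_one, InfGraph.Hom.map_tgtTo]
      exact (key X).1.2
    · rw [InfGraph.Hom.map_srcTo, InfGraph.Hom.map_tgtTo]
      exact (key X).2.1
    · rw [NMagma.Hom.map_comp_eq, NMagma.Hom.map_one, InfGraph.Hom.map_srcTo]
      exact (key X).2.2

noncomputable def freeProj (n : ℕ) (G : InfGraph.{u}) :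
    NMagma.Hom (freeMagma n G true) (freeMagma n G false) where
  map m q := ofVal (fun X => X.E.proj.map m (FreeCell.val q X))
    ((FreeCell.den q).elim fun t h => ⟨.proj t, _, h, rfl⟩)
  map_src m q := ext_val fun X => by
    simp only [freeMagma, freeGraph, val_ofVal]; exact X.E.proj.map_src _ _
  map_tgt m q := ext_val fun X => by
    simp only [freeMagma, freeGraph, val_ofVal]; exact X.E.proj.map_tgt _ _
  map_refl m q := ext_val fun X => by
    simp only [freeMagma, val_ofVal]; exact X.E.proj.map_refl _ _
  map_comp h y x c c' := ext_val fun X => by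
    simp only [freeMagma, val_ofVal]; exact X.E.proj.map_comp _ _ _ _ _
  map_rev hn h q := ext_val fun X => by
    simp only [freeMagma, val_ofVal]; exact X.E.proj.map_rev _ _ _

theorem freeProj_eval {n : ℕ} {G : InfGraph.{u}} {m : ℕ} {q q' : (freeMagma n G true).cell m}
    (h : (freeProj n G).map m q = (freeProj n G).map m q') (X : Under.{u} n G) :
    X.E.proj.map m (FreeCell.val q X) = X.E.proj.map m (FreeCell.val q' X) := by
  have := congrArg (fun r => FreeCell.val r X) h
  simpa only [freeProj, val_ofVal] using this

/-- The free `(∞,n)`-categorical stretching on `G`. -/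
noncomputable def free (n : ℕ) (G : InfGraph.{u}) : Stretching.{u} n where
  M := freeMagma n G true
  C := freeMagma n G false
  isStrict := freeMagma_isStrict n G
  proj := freeProj n G
  bracket q q' h h' := ofVal
    (fun X => X.E.bracket (FreeCell.val q X) (FreeCell.val q' X)
      ((evalHom true X).map_parallel h) (freeProj_eval h' X))
    ((FreeCell.den q).elim fun t ht => (FreeCell.den q').elim fun t' ht' =>
      ⟨.bracket t t', _, _, ht, ht', _, _, rfl⟩)
  tgt_bracket _ _ _ _ := ext_val fun X => by
    simp only [freeMagma, freeGraph, val_ofVal]; exact X.E.tgt_bracket _ _ _ _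
  src_bracket _ _ _ _ := ext_val fun X => by
    simp only [freeMagma, freeGraph, val_ofVal]; exact X.E.src_bracket _ _ _ _
  proj_bracket _ _ _ _ := ext_val fun X => by
    simp only [freeProj, freeMagma, val_ofVal]; exact X.E.proj_bracket _ _ _ _
  bracket_self _ _ _ := ext_val fun X => by
    simp only [freeMagma, val_ofVal]; exact X.E.bracket_self _ _ _

/-- The universal map from `G` to its free stretching. -/
noncomputable def freeUnit (n : ℕ) (G : InfGraph.{u}) :
    InfGraph.Hom G (free n G).M.toInfGraph where
  map m g := ofVal (fun X => X.g.map m g) ⟨.gen g, rfl⟩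
  map_src m g := ext_val fun X => by
    simp only [free, freeMagma, freeGraph, val_ofVal]; exact X.g.map_src _ _
  map_tgt m g := ext_val fun X => by
    simp only [free, freeMagma, freeGraph, val_ofVal]; exact X.g.map_tgt _ _

noncomputable def freeLift {n : ℕ} {G : InfGraph.{u}} (X : Under.{u} n G) : Hom (free n G) X.E where
  mapM := evalMagHom true X
  mapC := evalMagHom false X
  comm m x := by simp [evalMagHom, evalHom, free, freeProj]
  map_bracket c₁ c₀ h h' k k' := by simp [evalMagHom, evalHom, free]

/-- The components of a morphism out of the free stretching. -/
def Hom.mapMag {n : ℕ} {G : InfGraph.{u}} {E : Stretching.{u} n} (f : Hom (free n G) E) :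
    ∀ s : Bool, NMagma.Hom (freeMagma n G s) (E.mag s)
  | true => f.mapM
  | false => f.mapC

theorem exists_val {n : ℕ} {G : InfGraph.{u}} {s : Bool} {m : ℕ} {v : Val n G s m}
    (h : ∃ t, Den t v) : ∃ q : (freeMagma n G s).cell m, FreeCell.val q = v :=
  ⟨ofVal v h, val_ofVal v h⟩

theorem free_hom_ext_aux {n : ℕ} {G : InfGraph.{u}} {E : Stretching.{u} n}
    {f f' : Hom (free n G) E}
    (hf : ∀ m (x : G.cell m), f.mapM.map m ((freeUnit n G).map m x) =
      f'.mapM.map m ((freeUnit n G).map m x)) {s : Bool} {m : ℕ} (t : Tm n G s m) :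
    ∀ (v : Val n G s m), Den t v → ∀ q : (freeMagma n G s).cell m, FreeCell.val q = v →
      (f.mapMag s).map m q = (f'.mapMag s).map m q := by
  induction t with
  | gen g =>
    rintro v rfl q hq
    obtain rfl : q = (freeUnit n G).map _ g :=
      ext_val fun X => by rw [hq]; simp [freeUnit]
    exact hf _ g
  | proj t ih =>
    rintro v ⟨w, hw, rfl⟩ q hq
    obtain rfl : q = (freeProj n G).map _ (ofVal w ⟨t, hw⟩) :=
      ext_val fun X => by rw [hq]; simp [freeProj]
    have e := ih w hw (ofVal w ⟨t, hw⟩) (by simp)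
    have c := f.comm _ (ofVal w ⟨t, hw⟩)
    have c' := f'.comm _ (ofVal w ⟨t, hw⟩)
    exact c.symm.trans ((congrArg _ e).trans c')
  | @src s m t ih =>
    rintro v ⟨w, hw, rfl⟩ q hq
    obtain ⟨r, hr⟩ := exists_val ⟨t, hw⟩
    obtain rfl : q = (freeMagma n G s).src _ r :=
      ext_val fun X => by rw [hq]; simp [freeMagma, freeGraph, hr]
    rw [InfGraph.Hom.map_src, InfGraph.Hom.map_src]
    exact congrArg _ (ih w hw r hr)
  | @tgt s m t ih =>
    rintro v ⟨w, hw, rfl⟩ q hq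
    obtain ⟨r, hr⟩ := exists_val ⟨t, hw⟩
    obtain rfl : q = (freeMagma n G s).tgt _ r :=
      ext_val fun X => by rw [hq]; simp [freeMagma, freeGraph, hr]
    rw [InfGraph.Hom.map_tgt, InfGraph.Hom.map_tgt]
    exact congrArg _ (ih w hw r hr)
  | @refl s m t ih =>
    rintro v ⟨w, hw, rfl⟩ q hq
    obtain ⟨r, hr⟩ := exists_val ⟨t, hw⟩
    obtain rfl : q = (freeMagma n G s).refl _ r :=
      ext_val fun X => by rw [hq]; simp [freeMagma, hr]
    rw [NMagma.Hom.map_refl, NMagma.Hom.map_refl]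
    exact congrArg _ (ih w hw r hr)
  | @rev s p m hn h t ih =>
    rintro v ⟨w, hw, rfl⟩ q hq
    obtain ⟨r, hr⟩ := exists_val ⟨t, hw⟩
    obtain rfl : q = (freeMagma n G s).rev hn h r :=
      ext_val fun X => by rw [hq]; simp [freeMagma, hr]
    rw [NMagma.Hom.map_rev, NMagma.Hom.map_rev]
    exact congrArg _ (ih w hw r hr)
  | @comp s p m h t t' ih ih' =>
    rintro v ⟨w, w', hw, hw', c, rfl⟩ q hq
    obtain ⟨r, hr⟩ := exists_val ⟨t, hw⟩
    obtain ⟨r', hr'⟩ := exists_val ⟨t', hw'⟩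
    have c' : (freeMagma n G s).srcTo h.le r = (freeMagma n G s).tgtTo h.le r' :=
      ext_val fun X => by
        refine ((evalHom s X).map_srcTo h.le _).trans (Eq.trans ?_
          ((evalHom s X).map_tgtTo h.le _).symm)
        simpa [evalHom, hr, hr'] using c X
    obtain rfl : q = (freeMagma n G s).comp h r r' c' :=
      ext_val fun X => by rw [hq]; simp [freeMagma, hr, hr']
    rw [NMagma.Hom.map_comp_eq, NMagma.Hom.map_comp_eq]
    exact (E.mag s).comp_congr h (ih w hw r hr) (ih' w' hw' r' hr') _
  | @bracket m t t' ih ih' =>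
    rintro v ⟨w, w', hw, hw', k, k', rfl⟩ q hq
    have e := ih w hw (ofVal w ⟨t, hw⟩) (by simp)
    have e' := ih' w' hw' (ofVal w' ⟨t', hw'⟩) (by simp)
    have l : (free n G).M.Parallel (ofVal w ⟨t, hw⟩) (ofVal w' ⟨t', hw'⟩) := by
      cases m with
      | zero => trivial
      | succ m =>
        exact ⟨ext_val fun X => by simpa [free, freeMagma, freeGraph] using (k X).1,
          ext_val fun X => by simpa [free, freeMagma, freeGraph] using (k X).2⟩
    have l' : (freeProj n G).map m (ofVal w ⟨t, hw⟩) = (freeProj n G).map m (ofVal w' ⟨t', hw'⟩) :=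
      ext_val fun X => by simpa [freeProj] using k' X
    obtain rfl : q = (free n G).bracket (ofVal w ⟨t, hw⟩) (ofVal w' ⟨t', hw'⟩) l l' :=
      ext_val fun X => by rw [hq]; simp [free]
    have key : ∀ g : Hom (free n G) E, ∃ r r',
        (g.mapMag true).map _ ((free n G).bracket (ofVal w ⟨t, hw⟩) (ofVal w' ⟨t', hw'⟩) l l') =
          E.bracket ((g.mapMag true).map m (ofVal w ⟨t, hw⟩))
            ((g.mapMag true).map m (ofVal w' ⟨t', hw'⟩)) r r' := fun g =>
      ⟨g.mapM.map_parallel l, (g.comm m _).trans ((congrArg _ l').trans (g.comm m _).symm),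
        g.map_bracket _ _ l l' _ _⟩
    obtain ⟨r₁, r₂, h₁⟩ := key f
    obtain ⟨r₃, r₄, h₂⟩ := key f'
    rw [h₁, h₂]
    revert r₁ r₂
    rw [e, e']
    intros; rfl

theorem free_hom_ext {n : ℕ} {G : InfGraph.{u}} {E : Stretching.{u} n} {f f' : Hom (free n G) E}
    (hf : ∀ m (x : G.cell m), f.mapM.map m ((freeUnit n G).map m x) =
      f'.mapM.map m ((freeUnit n G).map m x)) : f = f' := by
  refine Hom.ext (NMagma.Hom.ext ?_) (NMagma.Hom.ext ?_)
  · funext m q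
    obtain ⟨t, ht⟩ := FreeCell.den q
    exact free_hom_ext_aux hf t _ ht q rfl
  · funext m q
    obtain ⟨t, ht⟩ := FreeCell.den q
    exact free_hom_ext_aux hf t _ ht q rfl

instance forget_isRightAdjoint (n : ℕ) : (forget.{u} n).IsRightAdjoint := by
  have : ∀ G : InfGraph.{u}, Limits.HasInitial (StructuredArrow G (forget.{u} n)) := fun G => by
    have i : Limits.IsInitial
        (StructuredArrow.mk (Y := free n G) (T := forget.{u} n) (freeUnit n G)) :=
      Limits.IsInitial.ofUniqueHom
        (fun Y => StructuredArrow.homMk (freeLift ⟨Y.right, Y.hom⟩) (by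
          refine InfGraph.Hom.ext ?_
          funext m x
          change FreeCell.val (FreeCell.ofVal _ _) (Under.mk Y.right Y.hom) = _
          rw [val_ofVal]))
        (fun Y f => by
          apply StructuredArrow.ext
          refine free_hom_ext fun m x => ?_
          have h₁ := StructuredArrow.w f
          have h₂ := congrFun (congrFun (congrArg InfGraph.Hom.map h₁) m) x
          refine h₂.trans ?_
          change _ = FreeCell.val (FreeCell.ofVal (s := true) (m := m) (fun X : Under.{u} n G => X.g.map m x) _)
            (Under.mk Y.right Y.hom)
          rw [val_ofVal])
    exact i.hasInitial
  exact isRightAdjointOfStructuredArrowInitials _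

end Stretching

/-! ## Weak `(∞,n)`-categories -/

/-- The monad `T^(∞,n)` on `∞`-graphs, generated by the adjunction between the free
`(∞,n)`-categorical stretching functor and the forgetful functor `Stretching.forget n`. Its
algebras are the weak `(∞,n)`-categories; for `n = 0`, the weak `∞`-groupoids. -/
noncomputable def weakMonad (n : ℕ) : Monad InfGraph.{u} :=
  (Adjunction.ofIsRightAdjoint (Stretching.forget.{u} n)).toMonad

namespace WeakAlgebra

variable {n : ℕ} (A : (weakMonad.{u} n).Algebra)

/-- The free stretching on the `∞`-graph underlying the algebra `(G, v)`. -/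
noncomputable def freeStretching : Stretching.{u} n := (Stretching.forget.{u} n).leftAdjoint.obj A.A

/-- The universal map `G → T(G)`. -/
noncomputable def unit : InfGraph.Hom A.A (freeStretching A).M.toInfGraph := (weakMonad n).η.app A.A

/-- The structure map `v : T(G) → G`. -/
def act : InfGraph.Hom (freeStretching A).M.toInfGraph A.A := A.a

theorem act_unit (m : ℕ) (x : A.A.cell m) : (act A).map m ((unit A).map m x) = x :=
  congrFun (congrFun (congrArg InfGraph.Hom.map A.unit) m) x

/-- The canonical `(∞,n)`-magma structure on the `∞`-graph underlying an algebra `(G, v)`: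
with `l` the universal map, `y ∘^m_p x = v(l(y) ⋆^m_p l(x))`, the reflexors are
`x ↦ v(1^m_{m+1}(l(x)))` and the reversors are `i^m_p(x) = v(j^m_p(l(x)))`. -/
noncomputable def magma : NMagma.{u} n where
  toInfGraph := A.A
  refl m x := (act A).map _ ((freeStretching A).M.refl m ((unit A).map m x))
  comp h y x c := (act A).map _ ((freeStretching A).M.comp h ((unit A).map _ y) ((unit A).map _ x)
    ((unit A).composable h.le c))
  rev hn h x := (act A).map _ ((freeStretching A).M.rev hn h ((unit A).map _ x))
  src_refl m x := by rw [← (act A).map_src, ReflGraph.src_refl, act_unit]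
  tgt_refl m x := by rw [← (act A).map_tgt, ReflGraph.tgt_refl, act_unit]
  src_comp_lt h h' y x c c' := by
    rw [← (act A).map_src, InfMagma.src_comp_lt _ h h' _ _ _ (by
      rw [← (unit A).map_src, ← (unit A).map_src]; exact (unit A).composable h.le c')]
    exact congrArg _ (InfMagma.comp_congr _ h ((unit A).map_src _ _).symm
      ((unit A).map_src _ _).symm _)
  tgt_comp_lt h h' y x c c' := by
    rw [← (act A).map_tgt, InfMagma.tgt_comp_lt _ h h' _ _ _ (by
      rw [← (unit A).map_tgt, ← (unit A).map_tgt]; exact (unit A).composable h.le c')]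
    exact congrArg _ (InfMagma.comp_congr _ h ((unit A).map_tgt _ _).symm
      ((unit A).map_tgt _ _).symm _)
  src_comp h y x c := by
    rw [← (act A).map_src, InfMagma.src_comp, ← (unit A).map_src, act_unit]
  tgt_comp h y x c := by
    rw [← (act A).map_tgt, InfMagma.tgt_comp, ← (unit A).map_tgt, act_unit]
  src_rev_lt hn h h' x := by
    rw [← (act A).map_src, NMagma.src_rev_lt _ hn h, (unit A).map_src]
  tgt_rev_lt hn h h' x := by
    rw [← (act A).map_tgt, NMagma.tgt_rev_lt _ hn h, (unit A).map_tgt]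
  src_rev hn h x := by
    rw [← (act A).map_src, NMagma.src_rev, ← (unit A).map_tgt, act_unit]
  tgt_rev hn h x := by
    rw [← (act A).map_tgt, NMagma.tgt_rev, ← (unit A).map_src, act_unit]

end WeakAlgebra

end Glob

namespace Glob

/-! ### Faces and identity cells in low dimension -/

namespace InfGraph

/-! Let `M → C` be the free stretching on `G`. Two parallel 1-cells of `M` with the same projection
in `C` are joined by a bracket, which is a 2-cell of `M`. The structure map `v` sends this bracket
to a 2-cell of `G`, hence to an identity cell, whose source and target coincide. So `v` identifies
the two 1-cells (`actHom_eq_of_proj_eq`).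

Every groupoid law is of this kind. For 1-cells of `G`, build both sides of the law in `M` from the
generators `λ(x)`. The sides are parallel by the positional axioms, and their projections agree
because `C` is a strict `(∞,0)`-category. Hence `v` takes the same value on both.

It remains to read these values as the two sides of the law in `G`. For a nested composite such as
`(z ∘ y) ∘ x` this requires `v` to be a morphism of magmas (`actHom`), although it is given only as
a map of `∞`-graphs. This follows from the associativity axiom of the algebra, because `T(v)` and
the multiplication of the monad both underlie morphisms of stretchings. -/

theorem srcTo_zero_one (X : InfGraph.{u}) (h : 0 ≤ 1) (x : X.cell 1) :
    X.srcTo h x = X.src 0 x := by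
  rw [X.srcTo_succ le_rfl, srcTo_self]

theorem tgtTo_zero_one (X : InfGraph.{u}) (h : 0 ≤ 1) (x : X.cell 1) :
    X.tgtTo h x = X.tgt 0 x := by
  rw [X.tgtTo_succ le_rfl, tgtTo_self]

end InfGraph

namespace ReflGraph

theorem one_succ (X : ReflGraph.{u}) {p m : ℕ} (h : p ≤ m) (h' : p ≤ m + 1) (x : X.cell p) :
    X.one h' x = X.refl m (X.one h x) := by
  unfold one; rw [Nat.leRec_succ (h1 := h)]

theorem one_zero_one (X : ReflGraph.{u}) (h : 0 ≤ 1) (x : X.cell 0) :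
    X.one h x = X.refl 0 x := by
  rw [X.one_succ le_rfl]; unfold one; rw [Nat.leRec_self]; rfl

/-- Since `p < m + 1`, the reflexor `1^p_{m+1}` ends with `1^m_{m+1}`, so both faces are the same
cell `1^p_m(x)`. This is the property of identity cells that makes brackets collapse. -/
theorem IsIdentity.src_eq_tgt {X : ReflGraph.{u}} {m : ℕ} {c : X.cell (m + 1)}
    (hc : X.IsIdentity c) : X.src m c = X.tgt m c := by
  obtain ⟨p, h, x, rfl⟩ := hc
  rw [X.one_succ (Nat.le_of_lt_succ h), X.src_refl, X.tgt_refl]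

end ReflGraph

/-- `1`-cells `y`, `x` with `s(y) = t(x)` are `∘^1_0`-composable. -/
theorem InfMagma.composable_one (X : InfMagma.{u}) {y x : X.cell 1}
    (c : X.src 0 y = X.tgt 0 x) :
    X.srcTo (one_pos : 0 < 1).le y = X.tgtTo (one_pos : 0 < 1).le x := by
  rw [X.srcTo_zero_one, X.tgtTo_zero_one, c]

/-! ### The structure map as a morphism of magmas -/

namespace WeakAlgebra

variable {n : ℕ} (A : (weakMonad.{u} n).Algebra)

/-- The free stretching on the `∞`-graph `T(G)`. -/
noncomputable def freeStretchingFree : Stretching.{u} n :=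
  (Stretching.forget.{u} n).leftAdjoint.obj ((weakMonad n).obj A.A)

/-- The morphism of stretchings `T(v)`, from the free stretching on `T(G)` to the free stretching
on `G`. -/
noncomputable def freeAct :
    freeStretchingFree A ⟶ freeStretching A :=
  (Stretching.forget.{u} n).leftAdjoint.map A.a

/-- The counit at the free stretching on `G`; it underlies the multiplication of the monad. -/
noncomputable def freeCounit :
    freeStretchingFree A ⟶ freeStretching A :=
  (Adjunction.ofIsRightAdjoint (Stretching.forget.{u} n)).counit.app (freeStretching A)

/-- The universal map `T(G) → T(T(G))`. -/
noncomputable def unitFree : InfGraph.Hom (freeStretching A).M.toInfGraph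
    (freeStretchingFree A).M.toInfGraph :=
  (weakMonad n).η.app ((weakMonad n).obj A.A)

/-- This is the associativity axiom `v ∘ T(v) = v ∘ μ` of the algebra. Its use is that `T(v)` and
`μ` come from morphisms of stretchings, and so preserve all the operations. -/
theorem act_freeAct (m : ℕ) (x) :
    (act A).map m ((freeAct A).mapM.map m x) = (act A).map m ((freeCounit A).mapM.map m x) :=
  (congrFun (congrFun (congrArg InfGraph.Hom.map A.assoc) m) x).symm

/-- The left unit law of the monad, with the unit taken at `T(G)`. -/
theorem freeCounit_unitFree (m : ℕ) (x) :
    (freeCounit A).mapM.map m ((unitFree A).map m x) = x :=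
  congrFun (congrFun (congrArg InfGraph.Hom.map ((weakMonad n).left_unit A.A)) m) x

/-- Naturality of the unit of the monad at `v`. -/
theorem freeAct_unitFree (m : ℕ) (x) :
    (freeAct A).mapM.map m ((unitFree A).map m x) = (unit A).map m ((act A).map m x) :=
  (congrFun (congrFun (congrArg InfGraph.Hom.map ((weakMonad n).η.naturality A.a)) m) x).symm

/-- The structure map of an algebra is a morphism of `(∞,n)`-magmas. -/
noncomputable def actHom : NMagma.Hom (freeStretching A).M (magma A) where
  toHom := act A
  map_refl m x := by
    -- Evaluate `v ∘ T(v) = v ∘ μ` at the reflexor of `λ_{T(G)}(x)`. On the left this gives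
    -- `v(1(λ(v(x))))`, the reflexor of `v(x)` in `G` by definition; on the right it gives
    -- `v(1(x))`. The other operations are treated in the same way.
    have := act_freeAct A _ (((freeStretchingFree A).M.refl m ((unitFree A).map m x)))
    rw [NMagma.Hom.map_refl, NMagma.Hom.map_refl, freeCounit_unitFree, freeAct_unitFree] at this
    exact this.symm
  map_comp {p m} h y x c c' := by
    have := act_freeAct A _ (InfMagma.comp _ h ((unitFree A).map m y) ((unitFree A).map m x)
      ((unitFree A).composable h.le c))
    rw [NMagma.Hom.map_comp_eq, NMagma.Hom.map_comp_eq,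
      -- A composite carries a proof of composability that depends on its two cells, so both are
      -- replaced at once by `comp_congr`.
      InfMagma.comp_congr _ h (freeAct_unitFree A _ _) (freeAct_unitFree A _ _),
      InfMagma.comp_congr _ h (freeCounit_unitFree A _ _) (freeCounit_unitFree A _ _)] at this
    exact this.symm
  map_rev {p m} hn h x := by
    have := act_freeAct A _ (NMagma.rev _ hn h ((unitFree A).map m x))
    rw [NMagma.Hom.map_rev, NMagma.Hom.map_rev, freeCounit_unitFree, freeAct_unitFree] at this
    exact this.symm

/-- The universal map `G → T(G)`, as a map from the underlying `∞`-graph of the magma `G`. -/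
noncomputable def unitHom : InfGraph.Hom (magma A).toInfGraph (freeStretching A).M.toInfGraph :=
  unit A

theorem actHom_unitHom (m : ℕ) (x : (magma A).cell m) :
    (actHom A).map m ((unitHom A).map m x) = x :=
  act_unit A m x

/-! ### Collapse of the brackets -/

/-- Parallel `m`-cells of the free stretching with the same projection have the same image under
the structure map, provided all `(m + 1)`-cells of the algebra are identities. -/
theorem actHom_eq_of_proj_eq {m : ℕ} (hA : ∀ c : (magma A).cell (m + 1), (magma A).IsIdentity c)
    {c₁ c₀ : (freeStretching A).M.cell m} (h : (freeStretching A).M.Parallel c₁ c₀)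
    (h' : (freeStretching A).proj.map m c₁ = (freeStretching A).proj.map m c₀) :
    (actHom A).map m c₁ = (actHom A).map m c₀ := by
  -- The image of the bracket has source `v(c₀)` and target `v(c₁)`.
  have := (hA ((actHom A).map _ ((freeStretching A).bracket c₁ c₀ h h'))).src_eq_tgt
  rw [← (actHom A).map_src, ← (actHom A).map_tgt, Stretching.src_bracket,
    Stretching.tgt_bracket] at this
  exact this.symm

/-! ### The groupoid laws for 1-cells -/

variable {A}

theorem comp_assoc_one (hA : ∀ c : (magma A).cell 2, (magma A).IsIdentity c)
    (z y x : (magma A).cell 1) (c₁ c₂ c₃ c₄) :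
    (magma A).comp one_pos ((magma A).comp one_pos z y c₁) x c₂ =
      (magma A).comp one_pos z ((magma A).comp one_pos y x c₃) c₄ := by
  have hzy := (InfGraph.srcTo_zero_one _ _ _).symm.trans
    (c₁.trans (InfGraph.tgtTo_zero_one _ _ _))
  have hyx := (InfGraph.srcTo_zero_one _ _ _).symm.trans
    (c₃.trans (InfGraph.tgtTo_zero_one _ _ _))
  have d₁ := (unitHom A).composable one_pos.le c₁
  have d₃ := (unitHom A).composable one_pos.le c₃
  -- The composites have to be formed in `M` before `v` is applied, so composability is checked
  -- again there, from the faces of the generators.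
  have d₂ := (freeStretching A).M.composable_one (y := InfMagma.comp _ one_pos _ _ d₁)
    (x := (unitHom A).map 1 x) (by
      rw [InfMagma.src_comp]
      exact ((unitHom A).map_src 0 y).symm.trans ((congrArg _ hyx).trans ((unitHom A).map_tgt 0 x)))
  have d₄ := (freeStretching A).M.composable_one (x := InfMagma.comp _ one_pos _ _ d₃)
    (y := (unitHom A).map 1 z) (by
      rw [InfMagma.tgt_comp]
      exact ((unitHom A).map_src 0 z).symm.trans ((congrArg _ hzy).trans ((unitHom A).map_tgt 0 y)))
  have key := actHom_eq_of_proj_eq A hA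
    (c₁ := InfMagma.comp _ one_pos _ _ d₂) (c₀ := InfMagma.comp _ one_pos _ _ d₄)
    -- Both sides have source `s(λ(x))` and target `t(λ(z))`; associativity itself is used only in
    -- `C`.
    ⟨by simp only [InfMagma.src_comp], by simp only [InfMagma.tgt_comp]⟩ (by
      simp only [NMagma.Hom.map_comp_eq]
      exact (freeStretching A).isStrict.isStrictCat.assoc _ _ _ _ _ _ _ _)
  simpa only [NMagma.Hom.map_comp_eq, actHom_unitHom] using key

/-- The unit law of `C`, transported along `v`. The source is a variable `a` with an equation
because the arrows of the groupoid carry their endpoints as equations; the next three laws have the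
same form. -/
theorem comp_refl_one (hA : ∀ c : (magma A).cell 2, (magma A).IsIdentity c)
    (x : (magma A).cell 1) {a : (magma A).cell 0} (ha : (magma A).src 0 x = a) (c) :
    (magma A).comp one_pos x ((magma A).refl 0 a) c = x := by
  subst ha
  have d := (freeStretching A).M.composable_one (y := (unitHom A).map 1 x)
    -- The identity is taken at `s(λ(x))`. Applying `v` turns this 0-cell into `s(v(λ(x))) = s(x)`.
    (x := (freeStretching A).M.refl 0 ((freeStretching A).M.src 0 ((unitHom A).map 1 x)))
    (ReflGraph.tgt_refl _ _ _).symm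
  have key := actHom_eq_of_proj_eq A hA
    (c₁ := InfMagma.comp _ one_pos _ _ d) (c₀ := (unitHom A).map 1 x)
    ⟨by simp only [InfMagma.src_comp, ReflGraph.src_refl], by simp only [InfMagma.tgt_comp]⟩ (by
      have := (freeStretching A).isStrict.isStrictCat.comp_one one_pos
        ((freeStretching A).proj.map 1 ((unitHom A).map 1 x)) (by
          rw [ReflGraph.one_zero_one]
          simp only [InfGraph.srcTo_zero_one, InfGraph.tgtTo_zero_one, ReflGraph.tgt_refl])
      simpa only [NMagma.Hom.map_comp_eq, NMagma.Hom.map_refl, InfGraph.Hom.map_src,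
        ReflGraph.one_zero_one, InfGraph.srcTo_zero_one] using this)
  simpa only [NMagma.Hom.map_comp_eq, NMagma.Hom.map_refl, InfGraph.Hom.map_src,
    actHom_unitHom] using key

theorem refl_comp_one (hA : ∀ c : (magma A).cell 2, (magma A).IsIdentity c)
    (x : (magma A).cell 1) {b : (magma A).cell 0} (hb : (magma A).tgt 0 x = b) (c) :
    (magma A).comp one_pos ((magma A).refl 0 b) x c = x := by
  subst hb
  have d := (freeStretching A).M.composable_one (x := (unitHom A).map 1 x)
    (y := (freeStretching A).M.refl 0 ((freeStretching A).M.tgt 0 ((unitHom A).map 1 x)))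
    (ReflGraph.src_refl _ _ _)
  have key := actHom_eq_of_proj_eq A hA
    (c₁ := InfMagma.comp _ one_pos _ _ d) (c₀ := (unitHom A).map 1 x)
    ⟨by simp only [InfMagma.src_comp], by simp only [InfMagma.tgt_comp, ReflGraph.tgt_refl]⟩ (by
      have := (freeStretching A).isStrict.isStrictCat.one_comp one_pos
        ((freeStretching A).proj.map 1 ((unitHom A).map 1 x)) (by
          rw [ReflGraph.one_zero_one]
          simp only [InfGraph.srcTo_zero_one, InfGraph.tgtTo_zero_one, ReflGraph.src_refl])
      simpa only [NMagma.Hom.map_comp_eq, NMagma.Hom.map_refl, InfGraph.Hom.map_tgt,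
        ReflGraph.one_zero_one, InfGraph.tgtTo_zero_one] using this)
  simpa only [NMagma.Hom.map_comp_eq, NMagma.Hom.map_refl, InfGraph.Hom.map_tgt,
    actHom_unitHom] using key

theorem comp_rev_one (hA : ∀ c : (magma A).cell 2, (magma A).IsIdentity c) (hn : n ≤ 0)
    (x : (magma A).cell 1) {b : (magma A).cell 0} (hb : (magma A).tgt 0 x = b) (c) :
    (magma A).comp one_pos x ((magma A).rev hn one_pos x) c = (magma A).refl 0 b := by
  subst hb
  have d := (freeStretching A).M.composable_one (y := (unitHom A).map 1 x)
    (x := (freeStretching A).M.rev hn one_pos ((unitHom A).map 1 x)) (NMagma.tgt_rev _ _ _ _).symm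
  have key := actHom_eq_of_proj_eq A hA
    (c₁ := InfMagma.comp _ one_pos _ _ d)
    (c₀ := (freeStretching A).M.refl 0 ((freeStretching A).M.tgt 0 ((unitHom A).map 1 x)))
    -- The source of the composite is `s(j(λ(x)))`, which equals `t(λ(x))` because the reversor
    -- exchanges the faces of a 1-cell.
    ⟨by simp only [InfMagma.src_comp, ReflGraph.src_refl, NMagma.src_rev],
      by simp only [InfMagma.tgt_comp, ReflGraph.tgt_refl]⟩ (by
      -- In `C` the reversor is a genuine inverse, and `proj` carries the reversor of `M` to it.
      obtain ⟨_, e⟩ := ((freeStretching A).isStrict.isInverse_rev hn one_pos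
        ((freeStretching A).proj.map 1 ((unitHom A).map 1 x))).1
      simpa only [NMagma.Hom.map_comp_eq, NMagma.Hom.map_refl, NMagma.Hom.map_rev,
        InfGraph.Hom.map_tgt, ReflGraph.one_zero_one, InfGraph.tgtTo_zero_one] using e)
  simpa only [NMagma.Hom.map_comp_eq, NMagma.Hom.map_refl, NMagma.Hom.map_rev,
    InfGraph.Hom.map_tgt, actHom_unitHom] using key

theorem rev_comp_one (hA : ∀ c : (magma A).cell 2, (magma A).IsIdentity c) (hn : n ≤ 0)
    (x : (magma A).cell 1) {a : (magma A).cell 0} (ha : (magma A).src 0 x = a) (c) :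
    (magma A).comp one_pos ((magma A).rev hn one_pos x) x c = (magma A).refl 0 a := by
  subst ha
  have d := (freeStretching A).M.composable_one (x := (unitHom A).map 1 x)
    (y := (freeStretching A).M.rev hn one_pos ((unitHom A).map 1 x)) (NMagma.src_rev _ _ _ _)
  have key := actHom_eq_of_proj_eq A hA
    (c₁ := InfMagma.comp _ one_pos _ _ d)
    (c₀ := (freeStretching A).M.refl 0 ((freeStretching A).M.src 0 ((unitHom A).map 1 x)))
    ⟨by simp only [InfMagma.src_comp, ReflGraph.src_refl],
      by simp only [InfMagma.tgt_comp, ReflGraph.tgt_refl, NMagma.tgt_rev]⟩ (by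
      obtain ⟨_, e⟩ := ((freeStretching A).isStrict.isInverse_rev hn one_pos
        ((freeStretching A).proj.map 1 ((unitHom A).map 1 x))).2
      simpa only [NMagma.Hom.map_comp_eq, NMagma.Hom.map_refl, NMagma.Hom.map_rev,
        InfGraph.Hom.map_src, ReflGraph.one_zero_one, InfGraph.srcTo_zero_one] using e)
  simpa only [NMagma.Hom.map_comp_eq, NMagma.Hom.map_refl, NMagma.Hom.map_rev,
    InfGraph.Hom.map_src, actHom_unitHom] using key

theorem isInverse_rev_one (hA : ∀ c : (magma A).cell 2, (magma A).IsIdentity c) (hn : n ≤ 0)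
    (x : (magma A).cell 1) : (magma A).IsInverse one_pos x ((magma A).rev hn one_pos x) := by
  have c := (magma A).composable_one (NMagma.tgt_rev _ hn one_pos x).symm
  have c' := (magma A).composable_one (NMagma.src_rev _ hn one_pos x)
  refine ⟨⟨c, (comp_rev_one hA hn x rfl c).trans ?_⟩, ⟨c', (rev_comp_one hA hn x rfl c').trans ?_⟩⟩
  · rw [ReflGraph.one_zero_one, InfGraph.tgtTo_zero_one]
  · rw [ReflGraph.one_zero_one, InfGraph.srcTo_zero_one]

/-! ### The groupoid and the proposition -/

/-- The groupoid of `0`-cells and `1`-cells of an algebra all of whose `2`-cells are identities. -/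
@[reducible] noncomputable def groupoid
    (hA : ∀ c : (magma A).cell 2, (magma A).IsIdentity c) (hn : n ≤ 0) :
    Groupoid.{u} ((magma A).cell 0) where
  Hom a b := {f : (magma A).cell 1 // (magma A).src 0 f = a ∧ (magma A).tgt 0 f = b}
  id a := ⟨(magma A).refl 0 a, ReflGraph.src_refl _ _ _, ReflGraph.tgt_refl _ _ _⟩
  comp f g := ⟨(magma A).comp one_pos g.1 f.1
      ((magma A).composable_one (g.2.1.trans f.2.2.symm)),
    (InfMagma.src_comp _ _ _ _ _).trans f.2.1, (InfMagma.tgt_comp _ _ _ _ _).trans g.2.2⟩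
  inv f := ⟨(magma A).rev hn one_pos f.1, (NMagma.src_rev _ _ _ _).trans f.2.2,
    (NMagma.tgt_rev _ _ _ _).trans f.2.1⟩
  -- Categorical composition is diagrammatic: `f ≫ g` is `g ∘ f`. So left and right are exchanged in
  -- the unit and inverse laws, and associativity is read backwards.
  id_comp f := Subtype.ext (comp_refl_one hA f.1 f.2.1
    ((magma A).composable_one (f.2.1.trans (ReflGraph.tgt_refl _ _ _).symm)))
  comp_id f := Subtype.ext (refl_comp_one hA f.1 f.2.2
    ((magma A).composable_one ((ReflGraph.src_refl _ _ _).trans f.2.2.symm)))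
  assoc f g h := by
    have hg := h.2.1.trans g.2.2.symm
    have gf := g.2.1.trans f.2.2.symm
    exact Subtype.ext (comp_assoc_one hA h.1 g.1 f.1 ((magma A).composable_one hg)
      ((magma A).composable_one ((InfMagma.src_comp _ _ _ _ _).trans gf))
      ((magma A).composable_one gf)
      ((magma A).composable_one (hg.trans (InfMagma.tgt_comp _ _ _ _ _).symm))).symm
  inv_comp f := Subtype.ext (comp_rev_one hA hn f.1 f.2.2
    ((magma A).composable_one (NMagma.tgt_rev _ _ _ _).symm))
  comp_inv f := Subtype.ext (rev_comp_one hA hn f.1 f.2.1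
    ((magma A).composable_one (NMagma.src_rev _ _ _ _)))

end WeakAlgebra

end Glob

theorem mainTheorem1 (A : (Glob.weakMonad.{u} 0).Algebra)
    (hA : (Glob.WeakAlgebra.magma A).HasDimension 1) :
    (∀ (a b : (Glob.WeakAlgebra.magma A).cell 0) (f : (Glob.WeakAlgebra.magma A).cell 1),
      (Glob.WeakAlgebra.magma A).src 0 f = a → (Glob.WeakAlgebra.magma A).tgt 0 f = b →
        (Glob.WeakAlgebra.magma A).src 0 ((Glob.WeakAlgebra.magma A).rev le_rfl one_pos f) = b ∧
        (Glob.WeakAlgebra.magma A).tgt 0 ((Glob.WeakAlgebra.magma A).rev le_rfl one_pos f) = a ∧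
        (Glob.WeakAlgebra.magma A).IsInverse one_pos f
          ((Glob.WeakAlgebra.magma A).rev le_rfl one_pos f)) ∧
    ∃ (𝒢 : Groupoid.{u} ((Glob.WeakAlgebra.magma A).cell 0))
      (e : ∀ a b : (Glob.WeakAlgebra.magma A).cell 0, 𝒢.Hom a b ≃
        {f : (Glob.WeakAlgebra.magma A).cell 1 //
          (Glob.WeakAlgebra.magma A).src 0 f = a ∧ (Glob.WeakAlgebra.magma A).tgt 0 f = b}),
      (∀ a, (e a a (𝟙 a) : (Glob.WeakAlgebra.magma A).cell 1) =
        (Glob.WeakAlgebra.magma A).refl 0 a) ∧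
      (∀ (a b c) (f : a ⟶ b) (g : b ⟶ c), ∃ h,
        (e a c (f ≫ g) : (Glob.WeakAlgebra.magma A).cell 1) =
          (Glob.WeakAlgebra.magma A).comp one_pos (e b c g) (e a b f) h) ∧
      (∀ (a b) (f : a ⟶ b), (e b a (Groupoid.inv f) : (Glob.WeakAlgebra.magma A).cell 1) =
        (Glob.WeakAlgebra.magma A).rev le_rfl one_pos (e a b f)) := by
  -- Brackets between 1-cells are 2-cells, so dimension 2 is where the identity condition is needed.
  have hA₂ := hA.1 2 one_lt_two
  refine ⟨fun a b f ha hb => ⟨(Glob.NMagma.src_rev _ _ _ _).trans hb,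
    (Glob.NMagma.tgt_rev _ _ _ _).trans ha, Glob.WeakAlgebra.isInverse_rev_one hA₂ _ f⟩,
    -- The arrows of this groupoid are by construction the 1-cells with the prescribed faces, so `e`
    -- is the identity and the compatibilities hold definitionally, apart from the composability
    -- witness.
    Glob.WeakAlgebra.groupoid hA₂ le_rfl, fun a b => Equiv.refl _, ?_, ?_, ?_⟩
  · intro a; rfl
  · intro a b c f g
    refine ⟨?_, rfl⟩
    rw [Glob.InfGraph.srcTo_zero_one, Glob.InfGraph.tgtTo_zero_one]
    exact (And.left (Subtype.prop g)).trans (And.right (Subtype.prop f)).symm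
  · intro a b f; rfl
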